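/- All graphs are finite and simple. For a graph $G$ and $k\in\mathbb{N}$, a total-$k$-coloring of $G$ is a map $\varphi: V(G)\cup E(G)\to\{1,\dots,k\}$ such that adjacent vertices receive different colors, distinct edges with a common endpoint receive different colors, and no edge receives the same color as one of its endpoints. If $H$ is a subgraph of $G$, a total-$k$-coloring $\varphi$ of $H$ is called a total-$k$-coloring of $H$ in $G$ if moreover $\varphi(u)\neq\varphi(v)$ for all $u,v\in V(H)$ that are adjacent in $G$ (even if they are not adjacent in $H$). Such a $\varphi$ extends to $G$ if there is a total-$k$-coloring of $G$ that agrees with $\varphi$ on all vertices and edges of $H$. Theorem. Let $G$ be a planar bipartite graph with maximum degree $\Delta$, let $d\ge 0$ be an integer, and let $H$ be a subgraph of $G$ of maximum degree at most $d$. Then every total-$(\Delta+d+4)$-coloring of $H$ in $G$ extends to $G$. -/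

import Mathlib

namespace TotalColoringExtension

/-- The Euclidean plane. -/
abbrev Plane : Type := EuclideanSpace ℝ (Fin 2)

/-- A drawing of `G` in the plane without crossings: the vertices are distinct points, every edge
is a simple arc joining its two ends, no arc contains a vertex other than at its two end points,
and two distinct arcs meet only in common end points. -/
structure PlaneDrawing {V : Type*} (G : SimpleGraph V) where
  /-- the point that represents a vertex -/
  point : V → Plane
  /-- the arc that represents an edge -/
  arc : G.edgeSet → C(unitInterval, Plane)
  point_injective : Function.Injective point
  arc_injective : ∀ e, Function.Injective (arc e)
  arc_ends : ∀ e : G.edgeSet, s(arc e 0, arc e 1) = e.1.map point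
  eq_end_of_arc_eq_point : ∀ (e : G.edgeSet) (t : unitInterval) (v : V),
    arc e t = point v → t = 0 ∨ t = 1
  eq_end_of_arc_eq_arc : ∀ e f : G.edgeSet, e ≠ f → ∀ s t : unitInterval,
    arc e s = arc f t → (s = 0 ∨ s = 1) ∧ (t = 0 ∨ t = 1)

/-- A graph is planar if it can be drawn in the plane without crossings. -/
def IsPlanar {V : Type*} (G : SimpleGraph V) : Prop :=
  Nonempty (PlaneDrawing G)

/-- A total-`k`-coloring of `G`: a proper vertex coloring and a proper edge coloring (that is, a
proper coloring of the line graph) with the same `k` colors, such that no edge has the color of one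
of its ends. -/
structure TotalColoring {V : Type*} (G : SimpleGraph V) (k : ℕ) where
  /-- the coloring of the vertices -/
  vert : G.Coloring (Fin k)
  /-- the coloring of the edges -/
  edge : G.lineGraph.Coloring (Fin k)
  edge_ne_vert : ∀ (e : G.edgeSet) (v : V), v ∈ e.1 → edge e ≠ vert v

/-- The total coloring `φ` of the subgraph `H` is a total coloring of `H` *in* `G`: vertices of `H`
that are adjacent in `G` (and possibly not in `H`) have different colors. -/
def TotalColoring.IsIn {V : Type*} {G : SimpleGraph V} {H : G.Subgraph} {k : ℕ}
    (φ : TotalColoring H.coe k) : Prop :=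
  ∀ u v : H.verts, G.Adj u v → φ.vert u ≠ φ.vert v

/-- The total coloring `ψ` of `G` agrees with the total coloring `φ` of the subgraph `H` on all the
vertices and edges of `H`. -/
def TotalColoring.Extends {V : Type*} {G : SimpleGraph V} {H : G.Subgraph} {k : ℕ}
    (ψ : TotalColoring G k) (φ : TotalColoring H.coe k) : Prop :=
  (∀ v : H.verts, ψ.vert v = φ.vert v) ∧
    ∀ e : H.coe.edgeSet, ψ.edge (H.hom.mapEdgeSet e) = φ.edge e

end TotalColoringExtension

namespace TotalColoringExtension

/-! Vertices outside `H` are colored greedily, there being more than `Δ` colors. An uncolored edge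
`uv` then loses at most `d_H(u) + 1` colors at `u` and `d_H(v) + 1` at `v`. As `d_H ≤ d`, with `Δ +
d + 2` colors its list keeps at least `Δ - min(d_H(u), d_H(v))` colors, hence at least as many as
there are uncolored edges at either end. The Borodin–Kostochka–Woodall theorem
`exists_list_edge_coloring` finishes.

That theorem rests on Galvin's method: a color is given to a stable matching among the edges whose
lists contain it, and any other such edge loses one color but also a preferred neighbor
(`exists_list_edge_coloring_of_preferences`). The rankings needed come from `exists_isBalanced`: a
matching `M` is peeled off whose ends on one side have maximum degree and which covers all their
neighbors of maximum degree (`exists_isPeelable`, by Hall and Mendelsohn–Dulmage). `M` is ranked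
first on that side and last on the other. An edge outside `M` that gains a preferred neighbor has
both end degrees below the maximum once `M` is gone, so there is room for the gain. -/

open Finset

/-! ### Stable matchings and Galvin's list coloring argument -/

open scoped Classical in
/-- Stable matchings exist: `p` and `q` rank the edges (small ranks are preferred) at the ends in
`A` and in `B`. -/
theorem exists_stable_matching {E A B : Type*} (a : E → A) (b : E → B) (p q : E → ℤ)
    (F : Finset E) (hp : ∀ e ∈ F, ∀ f ∈ F, a e = a f → p e = p f → e = f)
    (hq : ∀ e ∈ F, ∀ f ∈ F, b e = b f → q e = q f → e = f) :
    ∃ M ⊆ F, Set.InjOn a M ∧ Set.InjOn b M ∧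
      ∀ e ∈ F, e ∉ M → ∃ m ∈ M, (a m = a e ∧ p m < p e) ∨ (b m = b e ∧ q m < q e) := by
  induction F using Finset.strongInduction with
  | H F ih =>
  -- Gale–Shapley: an edge `f` ranked at its `B`-end below some `A`-end's first choice `e` can be
  -- discarded. If there is none, the first choices already form a matching.
  by_cases h : ∃ e ∈ F, ∃ f ∈ F, (∀ g ∈ F, a g = a e → p e ≤ p g) ∧ b e = b f ∧ q e < q f
  · obtain ⟨e, he, f, hf, htop, hb, hlt⟩ := h
    have hef : e ≠ f := by rintro rfl; exact lt_irrefl _ hlt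
    obtain ⟨M, hMF, hMa, hMb, hM⟩ := ih (F.erase f) (erase_ssubset hf)
      (fun x hx y hy => hp x (mem_of_mem_erase hx) y (mem_of_mem_erase hy))
      (fun x hx y hy => hq x (mem_of_mem_erase hx) y (mem_of_mem_erase hy))
    refine ⟨M, hMF.trans (erase_subset _ _), hMa, hMb, fun x hx hxM => ?_⟩
    by_cases hxf : x = f
    · subst hxf
      by_cases heM : e ∈ M
      · exact ⟨e, heM, Or.inr ⟨hb, hlt⟩⟩
      · obtain ⟨m, hm, ⟨h1, h2⟩ | ⟨h1, h2⟩⟩ := hM e (mem_erase.2 ⟨hef, he⟩) heM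
        · exact absurd (htop m (mem_of_mem_erase (hMF hm)) h1) (not_le.2 h2)
        · exact ⟨m, hm, Or.inr ⟨h1.trans hb, h2.trans hlt⟩⟩
    · exact hM x (mem_erase.2 ⟨hxf, hx⟩) hxM
  · push Not at h
    refine ⟨F.filter fun e => ∀ g ∈ F, a g = a e → p e ≤ p g, filter_subset _ _, ?_, ?_, ?_⟩
    · intro e he f hf hef
      simp only [coe_filter, Set.mem_ofPred_eq] at he hf
      exact hp e he.1 f hf.1 hef
        (le_antisymm (he.2 f hf.1 hef.symm) (hf.2 e he.1 hef))
    · intro e he f hf hef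
      simp only [coe_filter, Set.mem_ofPred_eq] at he hf
      exact hq e he.1 f hf.1 hef
        (le_antisymm (h f hf.1 e he.1 hf.2 hef.symm) (h e he.1 f hf.1 he.2 hef))
    · intro e he heM
      obtain ⟨m, hm, hmin⟩ := exists_min_image (F.filter fun g => a g = a e) p
        ⟨e, by simp [he]⟩
      simp only [mem_filter, and_imp] at hm hmin heM
      refine ⟨m, by
        simp only [mem_filter]
        exact ⟨hm.1, fun g hg hga => hmin g hg (hga.trans hm.2)⟩, Or.inl ⟨hm.2, ?_⟩⟩
      by_contra hlt
      exact heM ⟨he, fun g hg hga => (not_lt.1 hlt).trans (hmin g hg hga)⟩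

open scoped Classical in
/-- A bipartite multigraph can be colored from lists when, for suitable preferences, the list of
every edge is longer than the number of adjacent edges that are preferred to it. -/
theorem exists_list_edge_coloring_of_preferences {E A B C : Type*} [Nonempty C]
    (a : E → A) (b : E → B) (p q : E → ℤ)
    (F : Finset E) (L : E → Finset C)
    (hp : ∀ e ∈ F, ∀ f ∈ F, a e = a f → p e = p f → e = f)
    (hq : ∀ e ∈ F, ∀ f ∈ F, b e = b f → q e = q f → e = f)
    (hL : ∀ e ∈ F, #{f ∈ F | a f = a e ∧ p f < p e} + #{f ∈ F | b f = b e ∧ q f < q e} < #(L e)) :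
    ∃ col : E → C, (∀ e ∈ F, col e ∈ L e) ∧
      ∀ e ∈ F, ∀ f ∈ F, e ≠ f → (a e = a f ∨ b e = b f) → col e ≠ col f := by
  induction F using Finset.strongInduction generalizing L with
  | H F ih =>
  obtain rfl | ⟨e₀, he₀⟩ := F.eq_empty_or_nonempty
  · exact ⟨fun _ => Classical.arbitrary C, by simp, by simp⟩
  obtain ⟨α, hα⟩ : (L e₀).Nonempty := card_pos.1 (by have := hL e₀ he₀; omega)
  obtain ⟨M, hMF, hMa, hMb, hM⟩ := exists_stable_matching a b p q (F.filter fun e => α ∈ L e)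
    (fun x hx y hy => hp x (mem_of_mem_filter x hx) y (mem_of_mem_filter y hy))
    (fun x hx y hy => hq x (mem_of_mem_filter x hx) y (mem_of_mem_filter y hy))
  have hMF' : M ⊆ F := hMF.trans (filter_subset _ _)
  have hMne : M.Nonempty := by
    by_contra hne
    rw [not_nonempty_iff_eq_empty] at hne
    obtain ⟨m, hm, -⟩ := hM e₀ (by simp [he₀, hα]) (by simp [hne])
    simp [hne] at hm
  -- By stability, an edge that loses `α` also loses a preferred neighbor in `M`, so the strict
  -- inequality survives.
  obtain ⟨col, hcolL, hcol⟩ := ih (F \ M) (sdiff_ssubset hMF' hMne) (fun e => (L e).erase α)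
    (fun x hx y hy => hp x (mem_sdiff.1 hx).1 y (mem_sdiff.1 hy).1)
    (fun x hx y hy => hq x (mem_sdiff.1 hx).1 y (mem_sdiff.1 hy).1) (by
      intro e he
      rw [mem_sdiff] at he
      have h0 := hL e he.1
      have h1 : #{f ∈ F \ M | a f = a e ∧ p f < p e} ≤ #{f ∈ F | a f = a e ∧ p f < p e} :=
        card_le_card (filter_subset_filter _ sdiff_subset)
      have h2 : #{f ∈ F \ M | b f = b e ∧ q f < q e} ≤ #{f ∈ F | b f = b e ∧ q f < q e} :=
        card_le_card (filter_subset_filter _ sdiff_subset)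
      by_cases hαe : α ∈ L e
      · rw [card_erase_of_mem hαe]
        obtain ⟨m, hm, h | h⟩ := hM e (by simp [he.1, hαe]) he.2
        · have : #{f ∈ F \ M | a f = a e ∧ p f < p e} < #{f ∈ F | a f = a e ∧ p f < p e} :=
            card_lt_card ((ssubset_iff_of_subset (filter_subset_filter _ sdiff_subset)).2
              ⟨m, by simp [hMF' hm, h], by simp [hm]⟩)
          omega
        · have : #{f ∈ F \ M | b f = b e ∧ q f < q e} < #{f ∈ F | b f = b e ∧ q f < q e} :=
            card_lt_card ((ssubset_iff_of_subset (filter_subset_filter _ sdiff_subset)).2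
              ⟨m, by simp [hMF' hm, h], by simp [hm]⟩)
          omega
      · rw [erase_eq_of_notMem hαe]
        omega)
  have hne : ∀ e ∈ F, e ∉ M → col e ≠ α := fun e he heM =>
    ne_of_mem_erase (hcolL e (mem_sdiff.2 ⟨he, heM⟩))
  refine ⟨fun e => if e ∈ M then α else col e, fun e he => ?_, fun e he f hf hef hab => ?_⟩
  · by_cases heM : e ∈ M
    · simpa [heM] using (mem_filter.1 (hMF heM)).2
    · simpa [heM] using mem_of_mem_erase (hcolL e (mem_sdiff.2 ⟨he, heM⟩))
  · by_cases heM : e ∈ M <;> by_cases hfM : f ∈ M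
    · exact (hef (hab.elim (fun h => hMa heM hfM h) fun h => hMb heM hfM h)).elim
    · simpa [heM, hfM] using (hne f hf hfM).symm
    · simpa [heM, hfM] using hne e he heM
    · simpa [heM, hfM] using
        hcol e (mem_sdiff.2 ⟨he, heM⟩) f (mem_sdiff.2 ⟨hf, hfM⟩) hef hab

/-! ### Matchings covering prescribed vertices on both sides -/

/-- The Mendelsohn–Dulmage theorem: from a matching that saturates `S` and a matching of `T` into
`S` one gets a matching of `S` that also covers `T`. -/
theorem exists_injective_covering {S X : Type*} (r : S → X → Prop) (T : Set X) (f : S → X)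
    (hf : Function.Injective f) (hfr : ∀ s, r s (f s)) (g : T → S) (hg : Function.Injective g)
    (hgr : ∀ x : T, r (g x) x) :
    ∃ h : S → X, Function.Injective h ∧ (∀ s, r s (h s)) ∧ T ⊆ Set.range h := by
  classical
  let step : T → T → Prop := fun x y => f (g x) = y
  -- `R` is reached by alternating paths from the points of `T` missed by `f`; switching from `f` to
  -- `g` along them covers these points and uncovers none of `T`.
  let R : Set T := {y | ∃ x : T, x.1 ∉ Set.range f ∧ Relation.ReflTransGen step x y}
  have hclosed : ∀ x ∈ R, ∀ y : T, f (g x) = y → y ∈ R := fun x ⟨z, hz, hzx⟩ y hxy =>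
    ⟨z, hz, hzx.tail hxy⟩
  have hpred : ∀ y ∈ R, ∀ s, f s = y → ∃ x ∈ R, g x = s := by
    rintro y ⟨z, hz, hzy⟩ s hs
    obtain rfl | ⟨x, hzx, hxy⟩ := Relation.ReflTransGen.cases_tail hzy
    · exact (hz ⟨s, hs⟩).elim
    · exact ⟨x, ⟨z, hz, hzx⟩, hf (hxy.trans hs.symm)⟩
  let h : S → X := fun s => if hs : ∃ x ∈ R, g x = s then (hs.choose : X) else f s
  have hpos : ∀ x ∈ R, h (g x) = x := by
    intro x hx
    have hs : ∃ y ∈ R, g y = g x := ⟨x, hx, rfl⟩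
    simp only [h, dif_pos hs]
    rw [hg hs.choose_spec.2]
  have hneg : ∀ s, (¬ ∃ x ∈ R, g x = s) → h s = f s := fun s hs => dif_neg hs
  refine ⟨h, ?_, ?_, ?_⟩
  · intro s t hst
    by_cases hs : ∃ x ∈ R, g x = s <;> by_cases ht : ∃ x ∈ R, g x = t
    · obtain ⟨x, hx, rfl⟩ := hs
      obtain ⟨y, hy, rfl⟩ := ht
      rw [hpos x hx, hpos y hy] at hst
      rw [Subtype.ext hst]
    · obtain ⟨x, hx, rfl⟩ := hs
      rw [hpos x hx, hneg t ht] at hst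
      exact (ht (hpred x hx t hst.symm)).elim
    · obtain ⟨y, hy, rfl⟩ := ht
      rw [hpos y hy, hneg s hs] at hst
      exact (hs (hpred y hy s hst)).elim
    · rw [hneg s hs, hneg t ht] at hst
      exact hf hst
  · intro s
    by_cases hs : ∃ x ∈ R, g x = s
    · obtain ⟨x, hx, rfl⟩ := hs
      rw [hpos x hx]
      exact hgr x
    · rw [hneg s hs]
      exact hfr s
  · intro x hx
    by_cases hxR : (⟨x, hx⟩ : T) ∈ R
    · exact ⟨g ⟨x, hx⟩, hpos _ hxR⟩
    · obtain ⟨s, rfl⟩ : x ∈ Set.range f := by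
        by_contra hxf
        exact hxR ⟨⟨x, hx⟩, hxf, .refl⟩
      refine ⟨s, hneg s ?_⟩
      rintro ⟨y, hy, rfl⟩
      exact hxR (hclosed y hy ⟨_, hx⟩ rfl)

open scoped Classical in
/-- In a bipartite multigraph with all degrees at most `Δ`, let `S` be a set of vertices of degree
`Δ` on one side and `T` a set on the other side that satisfies Hall's condition towards `S`. Then
some matching covers exactly `S` on the one side and at least `T` on the other. -/
theorem exists_matching_covering {E A B : Type*} (a : E → A) (b : E → B) (F : Finset E) {Δ : ℕ}
    (hΔ : 0 < Δ) (ha : ∀ x, #{e ∈ F | a e = x} ≤ Δ) (S : Finset B)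
    (hS : ∀ y ∈ S, #{e ∈ F | b e = y} = Δ) (T : Finset A)
    (hT : ∀ U ⊆ T, #U ≤ #{y ∈ S | ∃ e ∈ F, a e ∈ U ∧ b e = y}) :
    ∃ M ⊆ F, Set.InjOn a M ∧ Set.InjOn b M ∧ M.image b = S ∧ T ⊆ M.image a := by
  -- Hall's condition for `S` is double counting: `Δ * #U` edges leave `U`, and each neighbor
  -- receives at most `Δ` of them.
  obtain ⟨f, hf, hfr⟩ := (all_card_le_biUnion_card_iff_exists_injective
    (fun y : S => (F.filter fun e => b e = y.1).image a)).1 (by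
      intro U
      let EU := F.filter fun e => b e ∈ U.image Subtype.val
      have h1 : EU.image a = U.biUnion fun y : S => (F.filter fun e => b e = y.1).image a := by
        ext x
        simp only [EU, mem_image, mem_filter, mem_biUnion]
        constructor
        · rintro ⟨e, ⟨he, y, hy, hye⟩, rfl⟩
          exact ⟨y, hy, e, ⟨he, hye.symm⟩, rfl⟩
        · rintro ⟨y, hy, e, ⟨he, hye⟩, rfl⟩
          exact ⟨e, ⟨he, y, hy, hye.symm⟩, rfl⟩
      have h2 : EU.image b = U.image Subtype.val := by
        ext y
        simp only [EU, mem_image, mem_filter]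
        constructor
        · rintro ⟨e, ⟨he, h⟩, rfl⟩
          exact h
        · rintro ⟨y, hy, rfl⟩
          obtain ⟨e, he⟩ : (F.filter fun e => b e = y.1).Nonempty :=
            card_pos.1 (by rw [hS y.1 y.2]; exact hΔ)
          rw [mem_filter] at he
          exact ⟨e, ⟨he.1, y, hy, he.2.symm⟩, he.2⟩
      have h3 : #EU ≤ Δ * #(EU.image a) := card_le_mul_card_image _ _ fun x _ =>
        (card_le_card (filter_subset_filter _ (filter_subset _ _))).trans (ha x)
      have h4 : Δ * #(EU.image b) ≤ #EU := mul_card_image_le_card _ _ fun y hy => by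
        rw [h2] at hy
        have hyS : y ∈ S := by
          obtain ⟨z, -, rfl⟩ := mem_image.1 hy
          exact z.2
        rw [← hS y hyS]
        refine card_le_card fun e he => ?_
        rw [mem_filter] at he
        simp only [EU, mem_filter]
        exact ⟨⟨he.1, he.2 ▸ hy⟩, he.2⟩
      rw [h2, card_image_of_injective _ Subtype.val_injective] at h4
      rw [← h1]
      exact Nat.le_of_mul_le_mul_left (h4.trans h3) hΔ)
  obtain ⟨g, hg, hgr⟩ := (all_card_le_biUnion_card_iff_exists_injective
    (fun x : T => {y ∈ S.attach | ∃ e ∈ F, a e = x.1 ∧ b e = y.1})).1 (by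
      intro U
      have h1 := hT (U.image Subtype.val) (by
        intro x hx
        obtain ⟨z, -, rfl⟩ := mem_image.1 hx
        exact z.2)
      rw [card_image_of_injective _ Subtype.val_injective] at h1
      refine h1.trans ?_
      rw [← card_image_of_injective _ (Subtype.val_injective (p := fun y => y ∈ S))]
      refine card_le_card fun y hy => ?_
      obtain ⟨hyS, e, he, hU, hye⟩ := mem_filter.1 hy
      obtain ⟨x, hx, hxe⟩ := mem_image.1 hU
      refine mem_image.2 ⟨⟨y, hyS⟩, mem_biUnion.2 ⟨x, hx, mem_filter.2 ⟨mem_attach _ _, ?_⟩⟩, rfl⟩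
      exact ⟨e, he, hxe.symm, hye⟩)
  obtain ⟨h, hinj, hr, hcov⟩ := exists_injective_covering
    (fun (y : S) (x : A) => ∃ e ∈ F, a e = x ∧ b e = y.1) {x | x ∈ T} f hf
    (fun y => by
      obtain ⟨e, he, hae⟩ := mem_image.1 (hfr y)
      exact ⟨e, (mem_filter.1 he).1, hae, (mem_filter.1 he).2⟩)
    g hg (fun x => (mem_filter.1 (hgr x)).2)
  choose m hmF hma hmb using hr
  refine ⟨univ.image m, ?_, ?_, ?_, ?_, ?_⟩
  · intro e he
    obtain ⟨y, -, rfl⟩ := mem_image.1 he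
    exact hmF y
  · intro e he f hf hef
    simp only [coe_image, coe_univ, Set.image_univ, Set.mem_range] at he hf
    obtain ⟨y, rfl⟩ := he
    obtain ⟨z, rfl⟩ := hf
    rw [hma, hma] at hef
    rw [hinj hef]
  · intro e he f hf hef
    simp only [coe_image, coe_univ, Set.image_univ, Set.mem_range] at he hf
    obtain ⟨y, rfl⟩ := he
    obtain ⟨z, rfl⟩ := hf
    rw [hmb, hmb] at hef
    rw [Subtype.ext hef]
  · ext y
    simp only [mem_image, mem_univ, true_and]
    constructor
    · rintro ⟨e, ⟨z, rfl⟩, rfl⟩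
      rw [hmb]
      exact z.2
    · exact fun hy => ⟨_, ⟨⟨y, hy⟩, rfl⟩, hmb _⟩
  · intro x hx
    obtain ⟨y, rfl⟩ := hcov hx
    exact mem_image.2 ⟨m y, mem_image_of_mem _ (mem_univ _), hma y⟩

/-! ### Peelable matchings -/

/-- A matching `M` as it is peeled off a bipartite multigraph with edge set `F` and all degrees at
most `Δ`: its ends on the side `B` have degree `Δ`, and it covers all their neighbors of degree
`Δ`. -/
def IsPeelable {E A B : Type*} [DecidableEq A] [DecidableEq B] (a : E → A) (b : E → B)
    (F : Finset E) (Δ : ℕ) (M : Finset E) : Prop :=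
  M ⊆ F ∧ M.Nonempty ∧ Set.InjOn a M ∧ Set.InjOn b M ∧
    (∀ m ∈ M, #{e ∈ F | b e = b m} = Δ) ∧
    ∀ e ∈ F, b e ∈ M.image b → #{f ∈ F | a f = a e} = Δ → a e ∈ M.image a

open scoped Classical in
theorem isPeelable_of_hall {E A B : Type*} (a : E → A) (b : E → B) (F : Finset E) {Δ : ℕ}
    (hΔ : 0 < Δ) (ha : ∀ x, #{e ∈ F | a e = x} ≤ Δ) (S : Finset B) (hne : S.Nonempty)
    (hS : ∀ y ∈ S, #{e ∈ F | b e = y} = Δ) (T : Finset A)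
    (hST : ∀ e ∈ F, b e ∈ S → #{f ∈ F | a f = a e} = Δ → a e ∈ T)
    (hT : ∀ U ⊆ T, #U ≤ #{y ∈ S | ∃ e ∈ F, a e ∈ U ∧ b e = y}) :
    ∃ M, IsPeelable a b F Δ M := by
  obtain ⟨M, hMF, hMa, hMb, hMS, hMT⟩ := exists_matching_covering a b F hΔ ha S hS T hT
  refine ⟨M, hMF, ?_, hMa, hMb, fun m hm => hS _ (hMS ▸ mem_image_of_mem _ hm), ?_⟩
  · rw [← hMS] at hne
    exact hne.of_image
  · intro e he hb hdeg
    exact hMT (hST e he (hMS ▸ hb) hdeg)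

open scoped Classical in
/-- Every bipartite multigraph with maximum degree `Δ > 0` has a peelable matching, for one of its
two sides. -/
theorem exists_isPeelable {E A B : Type*} (a : E → A) (b : E → B) (F : Finset E) {Δ : ℕ}
    (hΔ : 0 < Δ) (ha : ∀ x, #{e ∈ F | a e = x} ≤ Δ) (hb : ∀ y, #{e ∈ F | b e = y} ≤ Δ)
    (hex : (∃ x, #{e ∈ F | a e = x} = Δ) ∨ ∃ y, #{e ∈ F | b e = y} = Δ) :
    (∃ M, IsPeelable a b F Δ M) ∨ ∃ M, IsPeelable b a F Δ M := by
  let X : Finset A := (F.image a).filter fun x => #{e ∈ F | a e = x} = Δ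
  let Y : Finset B := (F.image b).filter fun y => #{e ∈ F | b e = y} = Δ
  have hX : ∀ x, x ∈ X ↔ #{e ∈ F | a e = x} = Δ := by
    intro x
    refine ⟨fun h => (mem_filter.1 h).2, fun h => mem_filter.2 ⟨?_, h⟩⟩
    obtain ⟨e, he⟩ : (F.filter fun e => a e = x).Nonempty := card_pos.1 (h ▸ hΔ)
    rw [mem_filter] at he
    exact mem_image.2 ⟨e, he⟩
  have hY : ∀ y, y ∈ Y ↔ #{e ∈ F | b e = y} = Δ := by
    intro y
    refine ⟨fun h => (mem_filter.1 h).2, fun h => mem_filter.2 ⟨?_, h⟩⟩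
    obtain ⟨e, he⟩ : (F.filter fun e => b e = y).Nonempty := card_pos.1 (h ▸ hΔ)
    rw [mem_filter] at he
    exact mem_image.2 ⟨e, he⟩
  let N : Finset B → Finset A := fun D => {x ∈ X | ∃ e ∈ F, b e ∈ D ∧ a e = x}
  by_cases hD : ∃ D ⊆ Y, D.Nonempty ∧ #(N D) ≤ #D
  · left
    obtain ⟨D₀, hD₀Y, hD₀ne, hD₀⟩ := hD
    -- Maximal deficiency forces Hall's condition from `N D` into `D`: otherwise deleting from `D`
    -- the neighbors `W` of a violating `U` would raise the deficiency.
    obtain ⟨D, hDmem, hDmax⟩ := exists_max_image (Y.powerset.filter fun D => D.Nonempty)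
      (fun D => (#D : ℤ) - #(N D)) ⟨D₀, by simp [hD₀Y, hD₀ne]⟩
    simp only [mem_filter, mem_powerset, and_imp] at hDmem hDmax
    have hdef : #(N D) ≤ #D := by
      have := hDmax D₀ hD₀Y hD₀ne
      omega
    refine isPeelable_of_hall a b F hΔ ha D hDmem.2 (fun y hy => (hY y).1 (hDmem.1 hy)) (N D)
      (fun e he hbe hdeg => mem_filter.2 ⟨(hX _).2 hdeg, e, he, hbe, rfl⟩) fun U hU => ?_
    let W : Finset B := {y ∈ D | ∃ e ∈ F, a e ∈ U ∧ b e = y}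
    change #U ≤ #W
    have hWD : W ⊆ D := filter_subset _ _
    have hcard : #(D \ W) + #W = #D := card_sdiff_add_card_eq_card hWD
    obtain hempty | hne := (D \ W).eq_empty_or_nonempty
    · have hUc := card_le_card hU
      rw [hempty, card_empty] at hcard
      omega
    · have h1 := hDmax (D \ W) (sdiff_subset.trans hDmem.1) hne
      have h2 : N (D \ W) ⊆ N D \ U := by
        intro x hx
        obtain ⟨hxX, e, he, hbe, rfl⟩ := mem_filter.1 hx
        rw [mem_sdiff] at hbe ⊢
        refine ⟨mem_filter.2 ⟨hxX, e, he, hbe.1, rfl⟩, fun hU' => hbe.2 ?_⟩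
        exact mem_filter.2 ⟨hbe.1, e, he, hU', rfl⟩
      have h3 := card_le_card h2
      have h4 : #(N D \ U) + #U = #(N D) := card_sdiff_add_card_eq_card hU
      omega
  -- Now Hall's condition holds for all of `Y` towards `X`, so the sides swap roles with `S = X` and
  -- `T = Y`.
  · right
    push Not at hD
    have hXne : X.Nonempty := by
      obtain ⟨x, hx⟩ | ⟨y, hy⟩ := hex
      · exact ⟨x, (hX x).2 hx⟩
      · have := hD {y} (by simpa using (hY y).2 hy) (by simp)
        obtain ⟨x, hx⟩ : (N {y}).Nonempty := card_pos.1 (by omega)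
        exact ⟨x, (mem_filter.1 hx).1⟩
    refine isPeelable_of_hall b a F hΔ hb X hXne (fun x hx => (hX x).1 hx) Y
      (fun e he hae hdeg => (hY _).2 hdeg) fun U hU => ?_
    obtain rfl | hne := U.eq_empty_or_nonempty
    · simp
    · exact (hD U hU hne).le

/-! ### Balanced rankings and the Borodin–Kostochka–Woodall theorem -/

open scoped Classical in
/-- Injective rankings of the edges at the vertices of both sides, such that for every edge `e` of
`F` the number of adjacent edges that are preferred to `e` is smaller than the larger of the
degrees of the two ends of `e`. -/
def IsBalanced {E A B : Type*} (a : E → A) (b : E → B) (F : Finset E) (p q : E → ℤ) : Prop :=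
  (∀ e ∈ F, ∀ f ∈ F, a e = a f → p e = p f → e = f) ∧
  (∀ e ∈ F, ∀ f ∈ F, b e = b f → q e = q f → e = f) ∧
  ∀ e ∈ F, #{f ∈ F | a f = a e ∧ p f < p e} + #{f ∈ F | b f = b e ∧ q f < q e} <
    max #{f ∈ F | a f = a e} #{f ∈ F | b f = b e}

theorem IsBalanced.swap {E A B : Type*} {a : E → A} {b : E → B} {F : Finset E} {p q : E → ℤ}
    (h : IsBalanced a b F p q) : IsBalanced b a F q p :=
  ⟨h.2.1, h.1, fun e he => by rw [add_comm, max_comm]; exact h.2.2 e he⟩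

open scoped Classical in
/-- Balanced rankings extend over a peelable matching, whose edges become the most preferred ones
on the side `B` and the least preferred ones on the side `A`. -/
theorem IsBalanced.extend {E A B : Type*} {a : E → A} {b : E → B} {F : Finset E} {Δ : ℕ}
    (ha : ∀ x, #{e ∈ F | a e = x} ≤ Δ) {M : Finset E}
    (hM : IsPeelable a b F Δ M) {p q : E → ℤ} (h : IsBalanced a b (F \ M) p q) :
    ∃ p' q', IsBalanced a b F p' q' := by
  obtain ⟨hMF, -, hMa, hMb, hMdeg, hMcov⟩ := hM
  obtain ⟨hp, hq, hlt⟩ := h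
  obtain ⟨P, hP⟩ := (F.image p).bddAbove
  obtain ⟨Q, hQ⟩ := (F.image q).bddBelow
  have hP' : ∀ e ∈ F, p e < P + 1 := fun e he =>
    Int.lt_add_one_of_le (hP (mem_coe.2 (mem_image_of_mem p he)))
  have hQ' : ∀ e ∈ F, Q - 1 < q e := fun e he =>
    Int.sub_one_lt_of_le (hQ (mem_coe.2 (mem_image_of_mem q he)))
  let p' : E → ℤ := fun e => if e ∈ M then P + 1 else p e
  let q' : E → ℤ := fun e => if e ∈ M then Q - 1 else q e
  have hpM : ∀ e ∈ M, p' e = P + 1 := fun e he => if_pos he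
  have hqM : ∀ e ∈ M, q' e = Q - 1 := fun e he => if_pos he
  have hpn : ∀ e, e ∉ M → p' e = p e := fun e he => if_neg he
  have hqn : ∀ e, e ∉ M → q' e = q e := fun e he => if_neg he
  refine ⟨p', q', ?_, ?_, ?_⟩
  · intro e he f hf hab hpe
    by_cases heM : e ∈ M <;> by_cases hfM : f ∈ M
    · exact hMa heM hfM hab
    · rw [hpM e heM, hpn f hfM] at hpe
      exact absurd hpe (hP' f hf).ne'
    · rw [hpn e heM, hpM f hfM] at hpe
      exact absurd hpe (hP' e he).ne
    · rw [hpn e heM, hpn f hfM] at hpe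
      exact hp e (mem_sdiff.2 ⟨he, heM⟩) f (mem_sdiff.2 ⟨hf, hfM⟩) hab hpe
  · intro e he f hf hab hqe
    by_cases heM : e ∈ M <;> by_cases hfM : f ∈ M
    · exact hMb heM hfM hab
    · rw [hqM e heM, hqn f hfM] at hqe
      exact absurd hqe (hQ' f hf).ne
    · rw [hqn e heM, hqM f hfM] at hqe
      exact absurd hqe (hQ' e he).ne'
    · rw [hqn e heM, hqn f hfM] at hqe
      exact hq e (mem_sdiff.2 ⟨he, heM⟩) f (mem_sdiff.2 ⟨hf, hfM⟩) hab hqe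
  · intro e he
    by_cases heM : e ∈ M
    · have h1 : #{f ∈ F | b f = b e ∧ q' f < q' e} = 0 := by
        rw [card_eq_zero, filter_eq_empty_iff]
        rintro f hf ⟨-, hlt'⟩
        rw [hqM e heM] at hlt'
        by_cases hfM : f ∈ M
        · rw [hqM f hfM] at hlt'
          exact lt_irrefl _ hlt'
        · rw [hqn f hfM] at hlt'
          exact lt_asymm hlt' (hQ' f hf)
      have h2 : #{f ∈ F | a f = a e ∧ p' f < p' e} < #{f ∈ F | a f = a e} :=
        card_lt_card ((ssubset_iff_of_subset (monotone_filter_right _ fun f _ hf => hf.1)).2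
          ⟨e, by simp [he], by simp⟩)
      rw [h1, add_zero]
      exact lt_max_of_lt_left h2
    · have heFM : e ∈ F \ M := mem_sdiff.2 ⟨he, heM⟩
      have hold := hlt e heFM
      have h1 : #{f ∈ F | a f = a e ∧ p' f < p' e} = #{f ∈ F \ M | a f = a e ∧ p f < p e} := by
        congr 1
        ext f
        simp only [mem_filter, mem_sdiff]
        by_cases hfM : f ∈ M
        · rw [hpM f hfM, hpn e heM]
          have := hP' e he
          constructor
          · rintro ⟨-, -, h⟩
            exact absurd h this.asymm
          · rintro ⟨⟨-, h⟩, -⟩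
            exact absurd hfM h
        · rw [hpn f hfM, hpn e heM]
          tauto
      have hda : #{f ∈ F \ M | a f = a e} ≤ #{f ∈ F | a f = a e} :=
        card_le_card (filter_subset_filter _ sdiff_subset)
      have hdb : #{f ∈ F \ M | b f = b e} ≤ #{f ∈ F | b f = b e} :=
        card_le_card (filter_subset_filter _ sdiff_subset)
      rw [h1]
      by_cases hbe : b e ∈ M.image b
      · obtain ⟨m, hm, hme⟩ := mem_image.1 hbe
        have h2 : #{f ∈ F | b f = b e ∧ q' f < q' e} ≤
            #{f ∈ F \ M | b f = b e ∧ q f < q e} + 1 := by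
          refine (card_le_card (t := insert m {f ∈ F \ M | b f = b e ∧ q f < q e}) ?_).trans
            (card_insert_le _ _)
          intro f hf
          obtain ⟨hfF, hbf, hqf⟩ := mem_filter.1 hf
          by_cases hfM : f ∈ M
          · exact mem_insert.2 (Or.inl (hMb hfM hm (hbf.trans hme.symm)))
          · rw [hqn f hfM, hqn e heM] at hqf
            exact mem_insert_of_mem (mem_filter.2 ⟨mem_sdiff.2 ⟨hfF, hfM⟩, hbf, hqf⟩)
        have hdeg : #{f ∈ F | b f = b e} = Δ := hme ▸ hMdeg m hm
        have h3 : #{f ∈ F \ M | b f = b e} < #{f ∈ F | b f = b e} :=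
          card_lt_card ((ssubset_iff_of_subset (filter_subset_filter _ sdiff_subset)).2
            ⟨m, by simp [hMF hm, hme], by simp [hm]⟩)
        -- With `h3`, both end degrees in `F \ M` are below `Δ`, so the old count is at most `Δ - 2`
        -- and can absorb the extra edge `m`.
        have h4 : #{f ∈ F \ M | a f = a e} < Δ := by
          by_cases hae : #{f ∈ F | a f = a e} = Δ
          · obtain ⟨m', hm', hme'⟩ := mem_image.1 (hMcov e he hbe hae)
            rw [← hae]
            exact card_lt_card ((ssubset_iff_of_subset (filter_subset_filter _ sdiff_subset)).2
              ⟨m', by simp [hMF hm', hme'], by simp [hm']⟩)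
          · exact lt_of_le_of_lt hda (lt_of_le_of_ne (ha _) hae)
        omega
      · have h2 : #{f ∈ F | b f = b e ∧ q' f < q' e} = #{f ∈ F \ M | b f = b e ∧ q f < q e} := by
          congr 1
          ext f
          simp only [mem_filter, mem_sdiff]
          by_cases hfM : f ∈ M
          · have : b f ≠ b e := fun h => hbe (h ▸ mem_image_of_mem b hfM)
            tauto
          · rw [hqn f hfM, hqn e heM]
            tauto
        omega

open scoped Classical in
theorem exists_isBalanced {E A B : Type*} (a : E → A) (b : E → B) (F : Finset E) :
    ∃ p q : E → ℤ, IsBalanced a b F p q := by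
  induction F using Finset.strongInduction with
  | H F ih =>
  obtain rfl | hne := F.eq_empty_or_nonempty
  · exact ⟨0, 0, by simp [IsBalanced]⟩
  obtain ⟨e₀, he₀, hmax⟩ := exists_max_image F
    (fun e => max #{f ∈ F | a f = a e} #{f ∈ F | b f = b e}) hne
  obtain ⟨Δ, hΔ⟩ : ∃ Δ, Δ = max #{f ∈ F | a f = a e₀} #{f ∈ F | b f = b e₀} := ⟨_, rfl⟩
  have hpos : 0 < Δ := by
    rw [hΔ]
    exact lt_max_of_lt_left (card_pos.2 ⟨e₀, by simp [he₀]⟩)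
  have ha : ∀ x, #{e ∈ F | a e = x} ≤ Δ := by
    intro x
    obtain h | ⟨e, he⟩ := (F.filter fun e => a e = x).eq_empty_or_nonempty
    · simp [h]
    · obtain ⟨heF, rfl⟩ := mem_filter.1 he
      exact (le_max_left _ _).trans (hΔ ▸ hmax e heF)
  have hb : ∀ y, #{e ∈ F | b e = y} ≤ Δ := by
    intro y
    obtain h | ⟨e, he⟩ := (F.filter fun e => b e = y).eq_empty_or_nonempty
    · simp [h]
    · obtain ⟨heF, rfl⟩ := mem_filter.1 he
      exact (le_max_right _ _).trans (hΔ ▸ hmax e heF)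
  have hex : (∃ x, #{e ∈ F | a e = x} = Δ) ∨ ∃ y, #{e ∈ F | b e = y} = Δ := by
    rcases max_choice #{f ∈ F | a f = a e₀} #{f ∈ F | b f = b e₀} with h | h
    · exact Or.inl ⟨a e₀, by rw [hΔ, h]⟩
    · exact Or.inr ⟨b e₀, by rw [hΔ, h]⟩
  obtain ⟨M, hM⟩ | ⟨M, hM⟩ := exists_isPeelable a b F hpos ha hb hex
  · obtain ⟨p, q, h⟩ := ih (F \ M) (sdiff_ssubset hM.1 hM.2.1)
    exact h.extend ha hM
  · obtain ⟨p, q, h⟩ := ih (F \ M) (sdiff_ssubset hM.1 hM.2.1)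
    obtain ⟨q', p', h'⟩ := h.swap.extend hb hM
    exact ⟨p', q', h'.swap⟩

open scoped Classical in
/-- The Borodin–Kostochka–Woodall theorem: a bipartite multigraph is edge-colorable from lists
when the list of every edge is at least as long as the larger degree of its two ends. -/
theorem exists_list_edge_coloring {E A B C : Type*} [Nonempty C] (a : E → A) (b : E → B)
    (F : Finset E) (L : E → Finset C)
    (hL : ∀ e ∈ F, max #{f ∈ F | a f = a e} #{f ∈ F | b f = b e} ≤ #(L e)) :
    ∃ col : E → C, (∀ e ∈ F, col e ∈ L e) ∧
      ∀ e ∈ F, ∀ f ∈ F, e ≠ f → (a e = a f ∨ b e = b f) → col e ≠ col f := by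
  obtain ⟨p, q, hp, hq, hlt⟩ := exists_isBalanced a b F
  exact exists_list_edge_coloring_of_preferences a b p q F L hp hq fun e he =>
    (hlt e he).trans_le (hL e he)

/-! ### Extending vertex and edge precolorings -/

open scoped Classical in
/-- With more than `Δ` colors, a proper precoloring of some of the vertices extends greedily. -/
theorem exists_vertex_coloring_extending {V : Type*} [Fintype V] (G : SimpleGraph V)
    [DecidableRel G.Adj] {k : ℕ} (hk : G.maxDegree < k) (s : Set V) (c₀ : V → Fin k)
    (h₀ : ∀ u ∈ s, ∀ v ∈ s, G.Adj u v → c₀ u ≠ c₀ v) :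
    ∃ c : V → Fin k, (∀ v ∈ s, c v = c₀ v) ∧ ∀ u v, G.Adj u v → c u ≠ c v := by
  suffices H : ∀ t : Finset V, ∃ c : V → Fin k, (∀ v ∈ s, c v = c₀ v) ∧
      ∀ u v, u ∈ s ∨ u ∈ t → v ∈ s ∨ v ∈ t → G.Adj u v → c u ≠ c v by
    obtain ⟨c, hc, hcG⟩ := H univ
    exact ⟨c, hc, fun u v => hcG u v (by simp) (by simp)⟩
  intro t
  induction t using Finset.induction_on with
  | empty =>
    exact ⟨c₀, fun _ _ => rfl, fun u v hu hv =>
      h₀ u (by simpa using hu) v (by simpa using hv)⟩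
  | insert x t hx ih =>
    obtain ⟨c, hc, hcG⟩ := ih
    by_cases hxs : x ∈ s
    · refine ⟨c, hc, fun u v hu hv => hcG u v ?_ ?_⟩
      · rcases hu with hu | hu
        · exact Or.inl hu
        · rcases mem_insert.1 hu with rfl | hu
          exacts [Or.inl hxs, Or.inr hu]
      · rcases hv with hv | hv
        · exact Or.inl hv
        · rcases mem_insert.1 hv with rfl | hv
          exacts [Or.inl hxs, Or.inr hv]
    -- All neighbors are avoided, even those whose value under `c` is still provisional; `k` exceeds
    -- their number.
    · obtain ⟨α, -, hα⟩ : ∃ α ∈ (univ : Finset (Fin k)), α ∉ (G.neighborFinset x).image c := by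
        refine exists_mem_notMem_of_card_lt_card ?_
        rw [card_univ, Fintype.card_fin]
        exact (card_image_le.trans (G.degree_le_maxDegree x)).trans_lt hk
      have hα' : ∀ y, G.Adj x y → c y ≠ α := fun y hy h =>
        hα (mem_image.2 ⟨y, by simpa using hy, h⟩)
      refine ⟨Function.update c x α, fun v hv => ?_, fun u v hu hv huv => ?_⟩
      · rw [Function.update_of_ne (by rintro rfl; exact hxs hv), hc v hv]
      · by_cases hux : u = x
        · subst hux
          rw [Function.update_self, Function.update_of_ne huv.ne']
          exact (hα' v huv).symm
        · by_cases hvx : v = x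
          · subst hvx
            rw [Function.update_self, Function.update_of_ne hux]
            exact hα' u huv.symm
          · rw [Function.update_of_ne hux, Function.update_of_ne hvx]
            exact hcG u v (hu.imp_right fun h => (mem_insert.1 h).resolve_left hux)
              (hv.imp_right fun h => (mem_insert.1 h).resolve_left hvx) huv

open scoped Classical in
/-- In a bipartite graph with all vertices colored, a precoloring of a subgraph `K` of maximum
degree at most `d` extends to all edges when there are at least `Δ + d + 2` colors. -/
theorem exists_edge_coloring_extending {V : Type*} [Fintype V] (G : SimpleGraph V)
    [DecidableRel G.Adj] (hbip : G.IsBipartite) (K : SimpleGraph V) (hK : K ≤ G) {d k : ℕ}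
    (hd : ∀ v, #{w | K.Adj v w} ≤ d) (hk : G.maxDegree + d + 2 ≤ k) (c : V → Fin k)
    (g : V → V → Fin k) (hsymm : ∀ u v, g u v = g v u)
    (hgK : ∀ u v w, K.Adj u v → K.Adj u w → v ≠ w → g u v ≠ g u w)
    (hgc : ∀ u v, K.Adj u v → g u v ≠ c u) :
    ∃ h : V → V → Fin k, (∀ u v, h u v = h v u) ∧ (∀ u v, K.Adj u v → h u v = g u v) ∧
      (∀ u v w, G.Adj u v → G.Adj u w → v ≠ w → h u v ≠ h u w) ∧
      ∀ u v, G.Adj u v → h u v ≠ c u := by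
  obtain ⟨side⟩ := hbip
  have hside : ∀ u v, G.Adj u v → (side u = 0 ↔ side v ≠ 0) := by
    intro u v huv
    have := side.valid huv
    omega
  have : Nonempty (Fin k) := ⟨⟨0, by omega⟩⟩
  -- Each uncolored edge appears once, directed away from side `0`, so that the two projections
  -- serve as its ends.
  let F : Finset (V × V) := {e | G.Adj e.1 e.2 ∧ ¬ K.Adj e.1 e.2 ∧ side e.1 = 0}
  let used : V → Finset (Fin k) := fun u =>
    insert (c u) ((univ.filter fun w => K.Adj u w).image (g u))
  let L : V × V → Finset (Fin k) := fun e => univ \ (used e.1 ∪ used e.2)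
  have hused : ∀ u, #(used u) ≤ #{w | K.Adj u w} + 1 := fun u =>
    (card_insert_le _ _).trans (Nat.add_le_add_right card_image_le 1)
  have hL : ∀ e, k ≤ #(L e) + (#{w | K.Adj e.1 w} + #{w | K.Adj e.2 w} + 2) := by
    intro e
    have h1 : #(L e) + #(used e.1 ∪ used e.2) = k := by
      rw [card_sdiff_add_card_eq_card (subset_univ _), card_univ, Fintype.card_fin]
    have h2 := card_union_le (used e.1) (used e.2)
    have h3 := hused e.1
    have h4 := hused e.2
    omega
  have hdeg : ∀ u, #{w | G.Adj u w ∧ ¬ K.Adj u w} + #{w | K.Adj u w} ≤ G.maxDegree := by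
    intro u
    rw [← card_union_of_disjoint]
    · refine le_trans (card_le_card fun w hw => ?_) (G.degree_le_maxDegree u)
      rw [SimpleGraph.mem_neighborFinset]
      simp only [mem_union, mem_filter, mem_univ, true_and] at hw
      exact hw.elim (fun h => h.1) fun h => hK h
    · rw [disjoint_filter]
      exact fun w _ h => h.2
  have hfst : ∀ u, #{e ∈ F | e.1 = u} ≤ #{w | G.Adj u w ∧ ¬ K.Adj u w} := by
    intro u
    refine card_le_card_of_injOn Prod.snd ?_ ?_
    · rintro ⟨x, y⟩ he
      simp only [F, coe_filter, mem_filter, mem_univ, true_and, Set.mem_ofPred_eq] at he ⊢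
      obtain ⟨⟨h1, h2, -⟩, rfl⟩ := he
      exact ⟨h1, h2⟩
    · rintro ⟨x, y⟩ he ⟨x', y'⟩ he' h
      simp only [coe_filter, Set.mem_ofPred_eq] at he he' h
      rw [he.2, he'.2, h]
  have hsnd : ∀ u, #{e ∈ F | e.2 = u} ≤ #{w | G.Adj u w ∧ ¬ K.Adj u w} := by
    intro u
    refine card_le_card_of_injOn Prod.fst ?_ ?_
    · rintro ⟨x, y⟩ he
      simp only [F, coe_filter, mem_filter, mem_univ, true_and, Set.mem_ofPred_eq] at he ⊢
      obtain ⟨⟨h1, h2, -⟩, rfl⟩ := he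
      exact ⟨h1.symm, fun h => h2 h.symm⟩
    · rintro ⟨x, y⟩ he ⟨x', y'⟩ he' h
      simp only [coe_filter, Set.mem_ofPred_eq] at he he' h
      rw [he.2, he'.2, h]
  obtain ⟨col, hcolL, hcol⟩ := exists_list_edge_coloring Prod.fst Prod.snd F L (by
    intro e _
    have h1 := hL e
    have h2 := hfst e.1
    have h3 := hsnd e.2
    have h4 := hdeg e.1
    have h5 := hdeg e.2
    have h6 := hd e.1
    have h7 := hd e.2
    omega)
  -- The value at non-adjacent pairs is constant, which keeps `h` symmetric.
  let h : V → V → Fin k := fun u v =>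
    if K.Adj u v then g u v else if G.Adj u v then
      if side u = 0 then col (u, v) else col (v, u) else Classical.arbitrary _
  have hK' : ∀ u v, K.Adj u v → h u v = g u v := fun u v huv => if_pos huv
  have hcol0 : ∀ u v, G.Adj u v → ¬ K.Adj u v → side u = 0 → h u v = col (u, v) := by
    intro u v h0 h1 h2
    simp only [h, if_neg h1, if_pos h0, if_pos h2]
  have hcol1 : ∀ u v, G.Adj u v → ¬ K.Adj u v → side u ≠ 0 → h u v = col (v, u) := by
    intro u v h0 h1 h2
    simp only [h, if_neg h1, if_pos h0, if_neg h2]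
  have hF0 : ∀ u v, G.Adj u v → ¬ K.Adj u v → side u = 0 → (u, v) ∈ F := by
    intro u v h0 h1 h2
    simp [F, h0, h1, h2]
  have hF1 : ∀ u v, G.Adj u v → ¬ K.Adj u v → side u ≠ 0 → (v, u) ∈ F := fun u v h0 h1 h2 =>
    hF0 v u h0.symm (fun h => h1 h.symm) ((hside v u h0.symm).2 h2)
  have hmem : ∀ u v, G.Adj u v → ¬ K.Adj u v → h u v ∉ used u := by
    intro u v huv hKuv
    by_cases hu : side u = 0
    · have := hcolL _ (hF0 u v huv hKuv hu)
      rw [hcol0 u v huv hKuv hu]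
      simp only [L, mem_sdiff, mem_union, not_or] at this
      exact this.2.1
    · have := hcolL _ (hF1 u v huv hKuv hu)
      rw [hcol1 u v huv hKuv hu]
      simp only [L, mem_sdiff, mem_union, not_or] at this
      exact this.2.2
  have hmix : ∀ u v w, G.Adj u v → ¬ K.Adj u v → K.Adj u w → h u v ≠ h u w := by
    intro u v w huv hKuv huw heq
    refine hmem u v huv hKuv (mem_insert_of_mem (mem_image.2 ⟨w, by simpa using huw, ?_⟩))
    rw [heq, hK' u w huw]
  refine ⟨h, fun u v => ?_, hK', fun u v w huv huw hvw => ?_, fun u v huv => ?_⟩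
  · by_cases hKuv : K.Adj u v
    · rw [hK' u v hKuv, hK' v u hKuv.symm, hsymm]
    · have hKvu : ¬ K.Adj v u := fun h => hKuv h.symm
      by_cases huv : G.Adj u v
      · by_cases hu : side u = 0
        · rw [hcol0 u v huv hKuv hu, hcol1 v u huv.symm hKvu ((hside u v huv).1 hu)]
        · rw [hcol1 u v huv hKuv hu, hcol0 v u huv.symm hKvu ((hside v u huv.symm).2 hu)]
      · have hvu : ¬ G.Adj v u := fun h => huv h.symm
        simp only [h, if_neg hKuv, if_neg hKvu, if_neg huv, if_neg hvu]
  · by_cases hKv : K.Adj u v <;> by_cases hKw : K.Adj u w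
    · rw [hK' u v hKv, hK' u w hKw]
      exact hgK u v w hKv hKw hvw
    · exact (hmix u w v huw hKw hKv).symm
    · exact hmix u v w huv hKv hKw
    · by_cases hu : side u = 0
      · rw [hcol0 u v huv hKv hu, hcol0 u w huw hKw hu]
        exact hcol _ (hF0 u v huv hKv hu) _ (hF0 u w huw hKw hu) (by simpa using hvw) (Or.inl rfl)
      · rw [hcol1 u v huv hKv hu, hcol1 u w huw hKw hu]
        exact hcol _ (hF1 u v huv hKv hu) _ (hF1 u w huw hKw hu) (by simpa using hvw) (Or.inr rfl)
  · by_cases hKuv : K.Adj u v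
    · rw [hK' u v hKuv]
      exact hgc u v hKuv
    · exact fun heq => hmem u v huv hKuv (heq ▸ mem_insert_self _ _)

/-! ### Assembling the total coloring -/

/-- A total coloring given by functions on the vertices and on the pairs of vertices. -/
def TotalColoring.ofFun {V : Type*} {G : SimpleGraph V} {k : ℕ} (c : V → Fin k)
    (h : V → V → Fin k) (hc : ∀ u v, G.Adj u v → c u ≠ c v) (hsymm : ∀ u v, h u v = h v u)
    (hh : ∀ u v w, G.Adj u v → G.Adj u w → v ≠ w → h u v ≠ h u w)
    (hhc : ∀ u v, G.Adj u v → h u v ≠ c u) : TotalColoring G k where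
  vert := SimpleGraph.Coloring.mk c fun {u v} huv => hc u v huv
  edge := SimpleGraph.Coloring.mk (fun e => Sym2.lift ⟨h, hsymm⟩ e.1) (by
    rintro ⟨e, he⟩ ⟨f, hf⟩ hef
    rw [SimpleGraph.lineGraph_adj_iff_exists] at hef
    obtain ⟨hne, u, hue, huf⟩ := hef
    obtain ⟨v, rfl⟩ := hue
    obtain ⟨w, rfl⟩ := huf
    refine hh u v w he hf ?_
    rintro rfl
    exact hne rfl)
  edge_ne_vert := by
    rintro ⟨e, he⟩ u hu
    obtain ⟨v, rfl⟩ := hu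
    exact hhc u v he

open scoped Classical in
/-- The extension theorem holds for all bipartite graphs, planar or not, and already with
`Δ + d + 2` colors. -/
theorem exists_totalColoring_extends {V : Type*} [Fintype V] (G : SimpleGraph V)
    [DecidableRel G.Adj] (hbip : G.IsBipartite) (H : G.Subgraph) {d k : ℕ}
    (hd : ∀ v, #{w | H.Adj v w} ≤ d) (hk : G.maxDegree + d + 2 ≤ k)
    (φ : TotalColoring H.coe k) (hφ : φ.IsIn) :
    ∃ ψ : TotalColoring G k, ψ.Extends φ := by
  let z : Fin k := ⟨0, by omega⟩
  obtain ⟨c, hcH, hc⟩ := exists_vertex_coloring_extending G (k := k) (by omega) H.verts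
    (fun v => if hv : v ∈ H.verts then φ.vert ⟨v, hv⟩ else z) (by
      intro u hu v hv huv
      rw [dif_pos hu, dif_pos hv]
      exact hφ ⟨u, hu⟩ ⟨v, hv⟩ huv)
  have hcφ : ∀ v : H.verts, c v = φ.vert v := fun v => by rw [hcH v v.2, dif_pos v.2]
  let g : V → V → Fin k := fun u v => if huv : H.Adj u v then
    φ.edge ⟨s(⟨u, huv.fst_mem⟩, ⟨v, huv.snd_mem⟩), huv⟩ else z
  have hg : ∀ u v (huv : H.Adj u v),
      g u v = φ.edge ⟨s(⟨u, huv.fst_mem⟩, ⟨v, huv.snd_mem⟩), huv⟩ := fun u v huv => dif_pos huv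
  obtain ⟨h, hsymm, hhg, hh, hhc⟩ := exists_edge_coloring_extending G hbip H.spanningCoe
    H.spanningCoe_le hd hk c g (by
      intro u v
      by_cases huv : H.Adj u v
      · rw [hg u v huv, hg v u huv.symm]
        congr 2
        exact Sym2.eq_swap
      · simp only [g, dif_neg huv, dif_neg fun h : H.Adj v u => huv h.symm]) (by
      intro u v w huv huw hvw
      rw [hg u v huv, hg u w huw]
      refine φ.edge.valid ?_
      rw [SimpleGraph.lineGraph_adj_iff_exists]
      refine ⟨?_, ⟨u, huv.fst_mem⟩, by simp, by simp⟩
      intro heq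
      have := Sym2.congr_right.1 (Subtype.ext_iff.1 heq)
      exact hvw (Subtype.ext_iff.1 this)) (by
      intro u v huv
      rw [hg u v huv, hcφ ⟨u, huv.fst_mem⟩]
      exact φ.edge_ne_vert _ _ (by simp))
  refine ⟨TotalColoring.ofFun c h hc hsymm hh hhc, hcφ, ?_⟩
  rintro ⟨e, he⟩
  induction e using Sym2.ind with
  | _ u v =>
    have huv : H.Adj u v := he
    exact (hhg u v huv).trans (hg u v huv)

end TotalColoringExtension

theorem mainTheorem4 {V : Type*} [Fintype V] (G : SimpleGraph V) [DecidableRel G.Adj]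
    (hplanar : TotalColoringExtension.IsPlanar G) (hbip : G.IsBipartite)
    (H : G.Subgraph) [∀ v : V, Fintype (H.neighborSet v)] (d : ℕ)
    (hd : ∀ v ∈ H.verts, H.degree v ≤ d)
    (φ : TotalColoringExtension.TotalColoring H.coe (G.maxDegree + d + 4)) (hφ : φ.IsIn) :
    ∃ ψ : TotalColoringExtension.TotalColoring G (G.maxDegree + d + 4), ψ.Extends φ := by
  classical
  refine TotalColoringExtension.exists_totalColoring_extends G hbip H (d := d) (fun v => ?_)
    (by omega) φ hφ
  -- The degree bound is given only on `H.verts`; other vertices have no neighbors in `H`.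
  by_cases hv : v ∈ H.verts
  · refine le_of_eq_of_le ?_ (hd v hv)
    rw [← SimpleGraph.Subgraph.finset_card_neighborSet_eq_degree]
    congr 1
    ext w
    simp
  · rw [Finset.card_eq_zero.2 (Finset.filter_eq_empty_iff.2 fun w _ h => hv h.fst_mem)]
    exact Nat.zero_le d
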